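/- Let $\mathcal{C}$ be a modular tensor category over $\mathbb{C}$ (a ribbon fusion category whose braiding $\beta$ is non-degenerate, i.e. whose only transparent simple object is the unit $\mathbf{1}$), let $\overline{\mathcal{C}}$ be $\mathcal{C}$ with the reversed braiding, and let $\mathfrak{Z}(\mathcal{C})$ be the Drinfeld center. Let $B$ be a 1d condensable algebra in $\mathcal{C}$, i.e. an indecomposable separable algebra. Conventions. If $\mathcal{D}$ is a braided monoidal category, $\mathcal{M}$ a monoidal category and $F:\mathcal{D}\to\mathfrak{Z}(\mathcal{M})$ a braided monoidal functor, put $A\odot N:=F(A)\otimes N$. For algebras $A$ in $\mathcal{D}$ and $N$ in $\mathcal{M}$, $A\odot N$ is an algebra in $\mathcal{M}$, with multiplication formed by moving $N$ past $F(A)$ along the inverse half-braiding of $F(A)$. A unital $A$-action on $N$ is an algebra homomorphism $A\odot N\to N$ whose composition with $N\cong\mathbf{1}\odot N\to A\odot N$ is $\mathrm{id}_N$. The left center of $N$ in $\mathcal{D}$ is a terminal object among the pairs consisting of an algebra in $\mathcal{D}$ and a unital action of it on $N$ (morphisms being the algebra homomorphisms compatible with the actions). For $\mathcal{M}=\mathcal{C}$,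 the left center $Z_l(B)$ is the left center of $B$ in $\mathcal{D}=\mathcal{C}$ for $F(X)=(X,\beta_{X,-})=:X\boxtimes\mathbf{1}$; the right center $Z_r(B)$ is the left center of $B$ in $\mathcal{D}=\overline{\mathcal{C}}$ for $F(Y)=(Y,\beta_{-,Y}^{-1})=:\mathbf{1}\boxtimes Y$; the full center $Z(B)$ is the left center of $B$ in $\mathcal{D}=\mathfrak{Z}(\mathcal{C})$ for $F=\mathrm{id}$. Identify $\mathcal{C}\boxtimes\overline{\mathcal{C}}$ with $\mathfrak{Z}(\mathcal{C})$ through the canonical functor $X\boxtimes Y\mapsto (X\boxtimes\mathbf{1})\otimes(\mathbf{1}\boxtimes Y)$, so that $\mathcal{C}\boxtimes\mathbf{1}$ and $\mathbf{1}\boxtimes\overline{\mathcal{C}}$ are full subcategories of $\mathfrak{Z}(\mathcal{C})$ (closed under isomorphism). For such a subcategory $\mathcal{P}$, $Z(B)\cap\mathcal{P}$ denotes the largest subobject of $Z(B)$ that lies in $\mathcal{P}$, with the algebra structure induced from $Z(B)$. Statement. Let $Z(B)$ be the full center of $B$. Then the intersections $Z(B)\cap(\mathcal{C}\boxtimes\mathbf{1})$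 and $Z(B)\cap(\mathbf{1}\boxtimes\overline{\mathcal{C}})$ and the left and right centers $Z_l(B)$ and $Z_r(B)$ exist, and there are isomorphisms of algebras in $\mathfrak{Z}(\mathcal{C})$ $$Z_l(B)\boxtimes\mathbf{1}\;\cong\; Z(B)\cap(\mathcal{C}\boxtimes\mathbf{1}),\qquad \mathbf{1}\boxtimes Z_r(B)\;\cong\; Z(B)\cap(\mathbf{1}\boxtimes\overline{\mathcal{C}}).$$ -/

import Mathlib

open CategoryTheory MonoidalCategory Limits MonObj

universe v v₁ u u₁

/-! ### Modular tensor categories -/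

attribute [local instance] Abelian.hasFiniteBiproducts

/-- A modular tensor category over `ℂ`: a braided fusion category with a ribbon structure whose
only transparent simple object is the unit. The underlying `ℂ`-linear abelian rigid braided
monoidal category (with bilinear tensor product) is given by the instance arguments. -/
class ModularTensorCategory (C : Type u) [Category.{v} C] [Abelian C] [Linear ℂ C]
    [MonoidalCategory C] [MonoidalPreadditive C] [MonoidalLinear ℂ C] [RigidCategory C]
    [BraidedCategory C] where
  finiteDimensional_hom : ∀ X Y : C, FiniteDimensional ℂ (X ⟶ Y)
  simple_unit : Simple (𝟙_ C)
  semisimple : ∀ X : C, ∃ (n : ℕ) (S : Fin n → C), (∀ i, Simple (S i)) ∧ Nonempty (X ≅ ⨁ S)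
  finite_simples : ∃ (n : ℕ) (S : Fin n → C), ∀ X : C, Simple X → ∃ i, Nonempty (X ≅ S i)
  /-- the ribbon twist -/
  twist : 𝟭 C ≅ 𝟭 C
  twist_tensor : ∀ X Y : C, twist.hom.app (X ⊗ Y) =
    (twist.hom.app X ⊗ₘ twist.hom.app Y) ≫ (β_ X Y).hom ≫ (β_ Y X).hom
  twist_dual : ∀ X : C, twist.hom.app (Xᘁ) = (twist.hom.app X)ᘁ
  nondegenerate : ∀ X : C, Simple X →
    (∀ Y : C, (β_ X Y).hom ≫ (β_ Y X).hom = 𝟙 (X ⊗ Y)) → Nonempty (X ≅ 𝟙_ C)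

/-! ### 1d condensable algebras -/

section Condensable

variable {C : Type u} [Category.{v} C] [MonoidalCategory C]

/-- The multiplication splits as a homomorphism of bimodules. -/
def IsSeparableAlg (B : Mon C) : Prop :=
  ∃ s : B.X ⟶ B.X ⊗ B.X, s ≫ μ[B.X] = 𝟙 B.X ∧
    B.X ◁ s ≫ (α_ B.X B.X B.X).inv ≫ μ[B.X] ▷ B.X = μ[B.X] ≫ s ∧
    s ▷ B.X ≫ (α_ B.X B.X B.X).hom ≫ B.X ◁ μ[B.X] = μ[B.X] ≫ s

/-- `B` is nonzero and is not the direct sum of two nonzero algebras. -/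
def IsIndecomposableAlg [Preadditive C] [HasBinaryBiproducts C] (B : Mon C) : Prop :=
  ¬ IsZero B.X ∧ ∀ (A₁ A₂ : Mon C) (p₁ : B ⟶ A₁) (p₂ : B ⟶ A₂),
    IsIso (biprod.lift p₁.hom p₂.hom) → IsZero A₁.X ∨ IsZero A₂.X

/-- A 1d (or `E₁`) condensable algebra is an indecomposable separable algebra. -/
def IsCondensableAlg [Preadditive C] [HasBinaryBiproducts C] (B : Mon C) : Prop :=
  IsSeparableAlg B ∧ IsIndecomposableAlg B

end Condensable

/-! ### The action of a braided category on a monoidal category -/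

section Action

variable {M : Type u} [Category.{v} M] [MonoidalCategory M]

/-- The algebra structure on `z ⊗ n` obtained by moving `n` past `z` along `s`. -/
@[reducible]
def twistedMonObj (z n : M) [MonObj z] [MonObj n] (s : n ⊗ z ⟶ z ⊗ n)
    (mul_left : μ[n] ▷ z ≫ s = (α_ n n z).hom ≫ n ◁ s ≫ (α_ n z n).inv ≫ s ▷ n ≫
      (α_ z n n).hom ≫ z ◁ μ[n])
    (one_left : η[n] ▷ z ≫ s = (λ_ z).hom ≫ (ρ_ z).inv ≫ z ◁ η[n])
    (mul_right : n ◁ μ[z] ≫ s = (α_ n z z).inv ≫ s ▷ z ≫ (α_ z n z).hom ≫ z ◁ s ≫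
      (α_ z z n).inv ≫ μ[z] ▷ n)
    (one_right : n ◁ η[z] ≫ s = (ρ_ n).hom ≫ (λ_ n).inv ≫ η[z] ▷ n) :
    MonObj (z ⊗ n) where
  one := (λ_ (𝟙_ M)).inv ≫ (η[z] ⊗ₘ η[n])
  mul := (α_ z n (z ⊗ n)).hom ≫ z ◁ ((α_ n z n).inv ≫ s ▷ n ≫ (α_ z n n).hom) ≫
    (α_ z z (n ⊗ n)).inv ≫ (μ[z] ⊗ₘ μ[n])
  one_mul := by
    calc
      _ = 𝟙 _ ⊗≫ η[z] ▷ (z ⊗ n) ⊗≫ z ◁ (η[n] ▷ z ≫ s) ▷ n ⊗≫ μ[z] ▷ (n ⊗ n) ⊗≫ z ◁ μ[n] := by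
        simp only [MonoidalCategory.tensorHom_def]
        monoidal
      _ = 𝟙 _ ⊗≫ (η[z] ▷ z ≫ μ[z]) ▷ n ⊗≫ z ◁ (η[n] ▷ n ≫ μ[n]) := by
        rw [one_left]
        calc
          _ = 𝟙 _ ⊗≫ η[z] ▷ (z ⊗ n) ⊗≫ (((z ⊗ z) ◁ η[n] ≫ μ[z] ▷ n) ▷ n) ⊗≫ z ◁ μ[n] := by
            monoidal
          _ = _ := by
            rw [whisker_exchange]; monoidal
      _ = _ := by
        rw [MonObj.one_mul, MonObj.one_mul]; monoidal
  mul_one := by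
    calc
      _ = 𝟙 _ ⊗≫ (z ⊗ n) ◁ (η[z] ▷ 𝟙_ M ≫ z ◁ η[n]) ⊗≫ z ◁ s ▷ n ⊗≫ (μ[z] ▷ (n ⊗ n) ≫ z ◁ μ[n]) := by
        simp only [MonoidalCategory.tensorHom_def]
        monoidal
      _ = 𝟙 _ ⊗≫ (z ⊗ n) ◁ η[n] ⊗≫ z ◁ (n ◁ η[z] ≫ s) ▷ n ⊗≫ (μ[z] ▷ (n ⊗ n) ≫ z ◁ μ[n]) := by
        rw [← whisker_exchange]; monoidal
      _ = 𝟙 _ ⊗≫ (z ◁ η[z] ≫ μ[z]) ▷ n ⊗≫ z ◁ (n ◁ η[n] ≫ μ[n]) := by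
        rw [one_right]
        calc
          _ = 𝟙 _ ⊗≫ z ◁ (𝟙_ M ◁ (n ◁ η[n]) ≫ η[z] ▷ (n ⊗ n)) ⊗≫ (μ[z] ▷ (n ⊗ n) ≫ z ◁ μ[n]) := by
            monoidal
          _ = 𝟙 _ ⊗≫ z ◁ (η[z] ▷ (n ⊗ 𝟙_ M)) ⊗≫ ((z ⊗ z) ◁ (n ◁ η[n]) ≫ μ[z] ▷ (n ⊗ n)) ⊗≫ z ◁ μ[n] := by
            rw [whisker_exchange]; monoidal
          _ = _ := by
            rw [whisker_exchange]; monoidal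
      _ = _ := by
        rw [MonObj.mul_one, MonObj.mul_one]; monoidal
  mul_assoc := by
    calc
      _ = 𝟙 _ ⊗≫ z ◁ s ▷ (n ⊗ z ⊗ n) ⊗≫ μ[z] ▷ (n ⊗ n ⊗ z ⊗ n) ⊗≫
            z ◁ (μ[n] ▷ z ≫ s) ▷ n ⊗≫ μ[z] ▷ (n ⊗ n) ⊗≫ z ◁ μ[n] := by
        simp only [MonoidalCategory.tensorHom_def]
        monoidal
      _ = 𝟙 _ ⊗≫ z ◁ s ▷ (n ⊗ z ⊗ n) ⊗≫ μ[z] ▷ (n ⊗ n ⊗ z ⊗ n) ⊗≫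
            z ◁ (n ◁ s ⊗≫ s ▷ n) ▷ n ⊗≫ (((z ⊗ z) ◁ μ[n] ≫ μ[z] ▷ n) ▷ n) ⊗≫ z ◁ μ[n] := by
        rw [mul_left]; monoidal
      _ = 𝟙 _ ⊗≫ z ◁ s ▷ (n ⊗ z ⊗ n) ⊗≫ (μ[z] ▷ (n ⊗ n ⊗ z ⊗ n) ≫
            z ◁ (𝟙 (n ⊗ n ⊗ z ⊗ n) ⊗≫ n ◁ s ▷ n ⊗≫ s ▷ (n ⊗ n) ⊗≫ 𝟙 (z ⊗ n ⊗ n ⊗ n))) ⊗≫ μ[z] ▷ (n ⊗ n ⊗ n) ⊗≫ z ◁ (μ[n] ▷ n ≫ μ[n]) := by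
        rw [whisker_exchange]; monoidal
      _ = 𝟙 _ ⊗≫ z ◁ s ▷ (n ⊗ z ⊗ n) ⊗≫
            (z ⊗ z) ◁ (𝟙 (n ⊗ n ⊗ z ⊗ n) ⊗≫ n ◁ s ▷ n ⊗≫ s ▷ (n ⊗ n)) ⊗≫ (μ[z] ▷ z ≫ μ[z]) ▷ (n ⊗ n ⊗ n) ⊗≫ z ◁ (μ[n] ▷ n ≫ μ[n]) := by
        rw [← whisker_exchange]; monoidal
      _ = 𝟙 _ ⊗≫ z ◁ (s ▷ (n ⊗ z) ≫ (z ⊗ n) ◁ s) ▷ n ⊗≫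
            (z ⊗ z) ◁ (s ▷ (n ⊗ n)) ⊗≫ (z ◁ μ[z] ≫ μ[z]) ▷ (n ⊗ n ⊗ n) ⊗≫ z ◁ (n ◁ μ[n] ≫ μ[n]) := by
        rw [MonObj.mul_assoc, MonObj.mul_assoc]; monoidal
      _ = 𝟙 _ ⊗≫ z ◁ n ◁ z ◁ s ▷ n ⊗≫ z ◁ (s ▷ z ⊗≫ z ◁ s ⊗≫ μ[z] ▷ n) ▷ (n ⊗ n) ⊗≫
           (μ[z] ▷ (n ⊗ (n ⊗ n)) ≫ z ◁ (n ◁ μ[n])) ⊗≫ z ◁ μ[n] := by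
        rw [← whisker_exchange]; monoidal
      _ = 𝟙 _ ⊗≫ z ◁ n ◁ z ◁ s ▷ n ⊗≫ z ◁ ((n ◁ μ[z] ≫ s) ▷ (n ⊗ n) ≫ (z ⊗ n) ◁ μ[n]) ⊗≫
           μ[z] ▷ (n ⊗ n) ⊗≫ z ◁ μ[n] := by
        rw [mul_right, ← whisker_exchange]; monoidal
      _ = 𝟙 _ ⊗≫ z ◁ n ◁ z ◁ s ▷ n ⊗≫ z ◁ (n ◁ (μ[z] ▷ (n ⊗ n) ≫ z ◁ μ[n])) ⊗≫ z ◁ s ▷ n ⊗≫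
           μ[z] ▷ (n ⊗ n) ⊗≫ z ◁ μ[n] := by
        have : (n ◁ μ[z] ≫ s) ▷ (n ⊗ n) ≫ (z ⊗ n) ◁ μ[n] =
            𝟙 _ ⊗≫ n ◁ (μ[z] ▷ (n ⊗ n) ≫ z ◁ μ[n]) ⊗≫ s ▷ n := by
          rw [comp_whiskerRight, Category.assoc, ← whisker_exchange]; monoidal
        rw [this]; monoidal
      _ = _ := by
        simp only [MonoidalCategory.tensorHom_def]
        monoidal

/-- Moving an object `N` past an object `Z` of the Drinfeld center, from left to right, along the
inverse of the half-braiding `Z ⊗ N ≅ N ⊗ Z`. -/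
def centerPass (Z : Center M) (N : M) :
    N ⊗ (Center.forget M).obj Z ⟶ (Center.forget M).obj Z ⊗ N :=
  (Z.2.β N).inv

lemma centerPass_naturality (Z : Center M) {N N' : M} (f : N ⟶ N') :
    f ▷ (Center.forget M).obj Z ≫ centerPass Z N' =
      centerPass Z N ≫ (Center.forget M).obj Z ◁ f :=
  (CommSq.mk (Z.2.naturality f)).vert_inv.w

lemma centerPass_hom {Z W : Center M} (f : Z ⟶ W) (N : M) :
    N ◁ (Center.forget M).map f ≫ centerPass W N =
      centerPass Z N ≫ (Center.forget M).map f ▷ N :=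
  (CommSq.mk (f.comm N)).vert_inv.w

lemma halfBraiding_inv_tensor {z : M} (h : HalfBraiding z) (N N' : M) :
    (h.β (N ⊗ N')).inv = (α_ N N' z).hom ≫ N ◁ (h.β N').inv ≫ (α_ N z N').inv ≫
      (h.β N).inv ▷ N' ≫ (α_ z N N').hom := by
  rw [← cancel_epi (h.β (N ⊗ N')).hom, Iso.hom_inv_id, h.monoidal]
  simp

lemma halfBraiding_inv_unit {z : M} (h : HalfBraiding z) :
    (h.β (𝟙_ M)).inv = (λ_ z).hom ≫ (ρ_ z).inv := by
  have h1 := (CommSq.mk (h.naturality (λ_ (𝟙_ M)).hom)).vert_inv.w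
  rw [halfBraiding_inv_tensor h] at h1
  have h3 : (λ_ z).inv ≫ (h.β (𝟙_ M)).inv ≫ (ρ_ z).hom =
      ((λ_ z).inv ≫ (h.β (𝟙_ M)).inv ≫ (ρ_ z).hom) ≫
        (λ_ z).inv ≫ (h.β (𝟙_ M)).inv ≫ (ρ_ z).hom := by
    calc
      _ = 𝟙 _ ⊗≫ ((λ_ (𝟙_ M)).hom ▷ z ≫ (h.β (𝟙_ M)).inv) ⊗≫ 𝟙 _ := by monoidal
      _ = 𝟙 _ ⊗≫ 𝟙_ M ◁ (h.β (𝟙_ M)).inv ⊗≫ (h.β (𝟙_ M)).inv ▷ 𝟙_ M ⊗≫ 𝟙 z := by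
        rw [h1]; monoidal
      _ = _ := by monoidal
  have h4 : (λ_ z).inv ≫ (h.β (𝟙_ M)).inv ≫ (ρ_ z).hom = 𝟙 z := by
    rw [← cancel_epi ((λ_ z).inv ≫ (h.β (𝟙_ M)).inv ≫ (ρ_ z).hom), ← h3, Category.comp_id]
  rw [Iso.inv_comp_eq, ← Iso.eq_comp_inv] at h4
  simpa using h4

lemma centerPass_tensor (Z : Center M) (N N' : M) :
    centerPass Z (N ⊗ N') = (α_ N N' _).hom ≫ N ◁ centerPass Z N' ≫ (α_ N _ N').inv ≫
      centerPass Z N ▷ N' ≫ (α_ _ N N').hom :=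
  halfBraiding_inv_tensor Z.2 N N'

lemma centerPass_unit (Z : Center M) :
    centerPass Z (𝟙_ M) = (λ_ _).hom ≫ (ρ_ _).inv :=
  halfBraiding_inv_unit Z.2

lemma tensor_centerPass (Z W : Center M) (N : M) :
    centerPass (Z ⊗ W) N = (α_ N ((Center.forget M).obj Z) ((Center.forget M).obj W)).inv ≫
      centerPass Z N ▷ _ ≫ (α_ _ N _).hom ≫ _ ◁ centerPass W N ≫ (α_ _ _ N).inv := by
  refine Eq.trans (b := (α_ N Z.1 W.1).inv ≫ (Z.2.β N).inv ▷ W.1 ≫ (α_ Z.1 N W.1).hom ≫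
    Z.1 ◁ (W.2.β N).inv ≫ (α_ Z.1 W.1 N).inv) ?_ rfl
  change (_ ≪≫ _).inv = _
  simp

lemma unit_centerPass (N : M) :
    centerPass (𝟙_ (Center M)) N = (ρ_ N).hom ≫ (λ_ N).inv :=
  rfl

/-- The algebra structure on `Z ⊗ N`, for an algebra `Z` in the Drinfeld center of `M` and an
algebra `N` in `M`. -/
noncomputable abbrev centerTensorMonObj (Z : Center M) [MonObj Z] (N : M) [MonObj N] :
    MonObj ((Center.forget M).obj Z ⊗ N) :=
  letI : MonObj ((Center.forget M).obj Z) := (Center.forget M).monObjObj Z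
  twistedMonObj ((Center.forget M).obj Z) N (centerPass Z N)
    (by rw [centerPass_naturality, centerPass_tensor]; simp)
    (by rw [centerPass_naturality, centerPass_unit]; simp)
    (by
      have e : ((Center.forget M).monObjObj Z).mul = (Center.forget M).map μ[Z] :=
        Category.id_comp _
      have h := centerPass_hom μ[Z] N
      rw [tensor_centerPass] at h
      rw [show μ[(Center.forget M).obj Z] = _ from e]
      refine h.trans ?_
      iterate 4 refine (Category.assoc _ _ _).trans (congrArg _ ?_)
      rfl)
    (by
      have e : ((Center.forget M).monObjObj Z).one = (Center.forget M).map η[Z] :=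
        Category.id_comp _
      have h := centerPass_hom η[Z] N
      rw [unit_centerPass] at h
      rw [show η[(Center.forget M).obj Z] = _ from e]
      refine h.trans ?_
      exact Category.assoc _ _ _)

variable {D : Type u₁} [Category.{v₁} D] [MonoidalCategory D] [BraidedCategory D]

/-- The object `A ⊙ N` of `M`, for the monoidal left `D`-module structure on `M` given by a braided
monoidal functor `F` from `D` to the Drinfeld center of `M`. -/
abbrev actObj (F : D ⥤ Center M) (A : D) (N : M) : M :=
  (Center.forget M).obj (F.obj A) ⊗ N

/-- The morphism `f ⊙ N`. -/
abbrev actMap (F : D ⥤ Center M) {A A' : D} (f : A ⟶ A') (N : M) : actObj F A N ⟶ actObj F A' N :=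
  (Center.forget M).map (F.map f) ▷ N

/-- The unit isomorphism `N ≅ 𝟙 ⊙ N`. -/
noncomputable def actUnitIso (F : D ⥤ Center M) [F.Braided] (N : M) : N ≅ actObj F (𝟙_ D) N :=
  (λ_ N).symm ≪≫ whiskerRightIso (Functor.Monoidal.εIso (F ⋙ Center.forget M)) N

/-- The algebra `A ⊙ N` in `M`, for algebras `A` in `D` and `N` in `M`. -/
noncomputable def actAlg (F : D ⥤ Center M) [F.Braided] (A : Mon D) (N : Mon M) : Mon M where
  X := actObj F A.X N.X
  mon :=
    letI : MonObj (F.obj A.X) := F.monObjObj A.X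
    centerTensorMonObj (F.obj A.X) N.X

/-- A unital `A`-action on the algebra `N`: an algebra homomorphism `A ⊙ N ⟶ N` whose composition
with `N ≅ 𝟙 ⊙ N ⟶ A ⊙ N` is the identity. -/
structure UnitalAction (F : D ⥤ Center M) [F.Braided] (A : Mon D) (N : Mon M) where
  /-- the algebra homomorphism `A ⊙ N ⟶ N` -/
  act : actAlg F A N ⟶ N
  unital : (actUnitIso F N.X).hom ≫ actMap F η[A.X] N.X ≫ act.hom = 𝟙 N.X

/-- The pair `(Z, u)` is a left center of `N` in `D`: it is terminal among the algebras in `D` with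
a unital action on `N`. -/
def IsLeftCenter (F : D ⥤ Center M) [F.Braided] (N : Mon M) (Z : Mon D)
    (u : UnitalAction F Z N) : Prop :=
  ∀ (X : Mon D) (t : UnitalAction F X N),
    ∃! f : X ⟶ Z, actMap F f.hom N.X ≫ u.act.hom = t.act.hom

/-- The pair `(Z, u)` is a full center of `N`: a left center of `N` in the Drinfeld center of `M`,
which acts on `M` through the identity functor. -/
def IsFullCenter (N : Mon M) (Z : Mon (Center M)) (u : UnitalAction (𝟭 (Center M)) Z N) : Prop :=
  IsLeftCenter (𝟭 (Center M)) N Z u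

end Action

/-! ### The two embeddings of a braided category into its Drinfeld center -/

section Embeddings

/-- The monoidal category `C`, to be equipped with the reversed braiding. -/
def RevBraided (C : Type u) : Type u := C

variable (C : Type u) [Category.{v} C] [MonoidalCategory C]

instance : Category.{v} (RevBraided C) := inferInstanceAs (Category.{v} C)

instance : MonoidalCategory (RevBraided C) := inferInstanceAs (MonoidalCategory C)

variable [BraidedCategory C]

instance : BraidedCategory (RevBraided C) := reverseBraiding C

/-- The canonical braided functor `X ↦ (X, β_{X,-})` from `C` to its Drinfeld center. It makes `C` a
monoidal left `C`-module with action given by the tensor product. -/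
noncomputable abbrev leftEmbedding : C ⥤ Center C := Center.ofBraided C

noncomputable instance : (leftEmbedding C).Braided where
  braided X Y := by
    apply Center.ext
    exact (Category.id_comp _).trans (Category.comp_id _).symm

/-- The canonical braided functor `Y ↦ (Y, β_{-,Y}⁻¹)` from `C` with the reversed braiding to the
Drinfeld center of `C`. It makes `C` a monoidal right `C`-module. -/
noncomputable def rightEmbedding : RevBraided C ⥤ Center C :=
  Center.ofBraided (RevBraided C)

noncomputable instance : (rightEmbedding C).Braided :=
  inferInstanceAs (leftEmbedding (RevBraided C)).Braided


variable {C}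

/-- The object `X ⊠ Y` of the Drinfeld center of `C`, that is, the image of the object `X ⊠ Y` of
the Deligne product of `C` and its reverse under the canonical functor to the center. -/
noncomputable def boxProd (X : C) (Y : RevBraided C) : Center C :=
  (leftEmbedding C).obj X ⊗ (rightEmbedding C).obj Y

variable (C)

/-- The full subcategory `C ⊠ 𝟙` of the Drinfeld center. -/
def leftFactor : ObjectProperty (Center C) :=
  fun W => ∃ X : C, Nonempty (W ≅ boxProd X (𝟙_ (RevBraided C)))

/-- The full subcategory `𝟙 ⊠ C̄` of the Drinfeld center. -/
def rightFactor : ObjectProperty (Center C) :=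
  fun W => ∃ Y : RevBraided C, Nonempty (W ≅ boxProd (𝟙_ C) Y)

end Embeddings

/-- The algebra `I`, with the homomorphism `j` to the algebra `Z`, is the intersection of `Z` with
the full subcategory `P`: the largest subobject of `Z` that belongs to `P`, with the algebra
structure induced from `Z`. -/
structure IsIntersection {E : Type u} [Category.{v} E] [MonoidalCategory E]
    (P : ObjectProperty E) {I Z : Mon E} (j : I ⟶ Z) : Prop where
  mono : Mono j.hom
  mem : P I.X
  largest : ∀ (S : E) (s : S ⟶ Z.X), Mono s → P S → ∃ g : S ⟶ I.X, g ≫ j.hom = s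

/-! Both sides of each isomorphism come from one object: the coreflection `i : F.obj R ⟶ Z.X` of the
full center along the embedding `F`. An action of `A` through `F` is the same as an action of the
algebra `F(A)` in the Drinfeld center, hence an algebra homomorphism `F(A) ⟶ Z`. Coreflecting along
a monoidal functor carries algebras to algebras, so these correspond to homomorphisms `A ⟶ R`, and
`R` is the left center (`IsFullCenter.isLeftCenter`). If `i` is mono, every subobject in the
essential image of `F` factors through it, so `F(R)` is also the intersection
(`IsCoreflection.isIntersection`). Uniqueness of both then gives the isomorphism.

It remains to construct `R` (`exists_leftEmbedding_mono`). A morphism from `(Y, β)` to `Z` is an `f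
: Y ⟶ Z.1` that kills the difference of half-braiding and braiding at every `U`. By duality this
says that composites of `f` vanish, and by semisimplicity finitely many `U` suffice, so `R` is a
kernel. The right embedding is the left one for the reversed braiding. -/

/-! ### Coreflections of algebras along a monoidal functor -/

section Coreflection

variable {D : Type u₁} [Category.{v₁} D] {E : Type u} [Category.{v} E]

/-- The morphism `i` is universal among the morphisms to `W` from objects in the image of `F`. -/
def IsCoreflection (F : D ⥤ E) {R : D} {W : E} (i : F.obj R ⟶ W) : Prop :=
  ∀ (Y : D) (f : F.obj Y ⟶ W), ∃! g : Y ⟶ R, F.map g ≫ i = f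

namespace IsCoreflection

variable {F : D ⥤ E} {R : D} {W : E} {i : F.obj R ⟶ W}

lemma hom_ext (h : IsCoreflection F i) {Y : D} {g g' : Y ⟶ R}
    (w : F.map g ≫ i = F.map g' ≫ i) : g = g' :=
  (h Y (F.map g' ≫ i)).unique w rfl

/-- The factorization of a morphism through a coreflection. -/
noncomputable def lift (h : IsCoreflection F i) {Y : D} (f : F.obj Y ⟶ W) : Y ⟶ R :=
  (h Y f).choose

lemma map_lift (h : IsCoreflection F i) {Y : D} (f : F.obj Y ⟶ W) : F.map (h.lift f) ≫ i = f :=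
  (h Y f).choose_spec.1

variable [MonoidalCategory D] [MonoidalCategory E] [F.Monoidal]

open Functor.LaxMonoidal Functor.OplaxMonoidal

/-- The coreflection of an algebra is an algebra. -/
@[reducible]
noncomputable def monObj (h : IsCoreflection F i) [MonObj W] : MonObj R where
  one := h.lift (Functor.OplaxMonoidal.η F ≫ MonObj.one)
  mul := h.lift (δ F R R ≫ (i ⊗ₘ i) ≫ MonObj.mul)
  -- By `hom_ext` each axiom is tested after `F.map` and `i`, where `map_lift` turns it into the
  -- axiom of `W`.
  one_mul := h.hom_ext <| by
    rw [Functor.map_comp, Category.assoc, h.map_lift, ← δ_natural_left_assoc,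
      MonoidalCategory.tensorHom_def, Category.assoc, ← comp_whiskerRight_assoc, h.map_lift,
      comp_whiskerRight_assoc, ← whisker_exchange_assoc, MonObj.one_mul, leftUnitor_naturality,
      Functor.Monoidal.map_leftUnitor]
    simp
  mul_one := h.hom_ext <| by
    rw [Functor.map_comp, Category.assoc, h.map_lift, ← δ_natural_right_assoc,
      MonoidalCategory.tensorHom_def', Category.assoc, ← whiskerLeft_comp_assoc, h.map_lift,
      MonoidalCategory.whiskerLeft_comp_assoc, whisker_exchange_assoc, MonObj.mul_one,
      rightUnitor_naturality, Functor.Monoidal.map_rightUnitor]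
    simp
  mul_assoc := h.hom_ext <| by
    have e₁ : δ F (R ⊗ R) R ≫ F.map (h.lift (δ F R R ≫ (i ⊗ₘ i) ≫ μ[W])) ▷ F.obj R ≫ (i ⊗ₘ i) =
        δ F (R ⊗ R) R ≫ δ F R R ▷ F.obj R ≫ ((i ⊗ₘ i) ⊗ₘ i) ≫ μ[W] ▷ W := by
      simp only [← tensorHom_id, tensorHom_comp_tensorHom, Category.id_comp, Category.comp_id,
        h.map_lift]
    have e₂ : δ F R (R ⊗ R) ≫ F.obj R ◁ F.map (h.lift (δ F R R ≫ (i ⊗ₘ i) ≫ μ[W])) ≫ (i ⊗ₘ i) =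
        δ F R (R ⊗ R) ≫ F.obj R ◁ δ F R R ≫ (i ⊗ₘ (i ⊗ₘ i)) ≫ W ◁ μ[W] := by
      simp only [← id_tensorHom, tensorHom_comp_tensorHom, Category.id_comp, Category.comp_id,
        h.map_lift]
    rw [Functor.map_comp, Category.assoc, h.map_lift, ← δ_natural_left_assoc, reassoc_of% e₁,
      MonObj.mul_assoc, Functor.map_comp, Functor.map_comp, Category.assoc, Category.assoc,
      h.map_lift, ← δ_natural_right_assoc, reassoc_of% e₂, associator_naturality_assoc,
      Functor.OplaxMonoidal.associativity_assoc]

/-- The coreflection of an algebra, as an algebra. -/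
noncomputable def mon {W : Mon E} {i : F.obj R ⟶ W.X} (h : IsCoreflection F i) : Mon D where
  X := R
  mon := h.monObj

/-- The counit of a coreflection of algebras. -/
noncomputable def counit {W : Mon E} {i : F.obj R ⟶ W.X} (h : IsCoreflection F i) :
    F.mapMon.obj h.mon ⟶ W where
  hom := i
  isMonHom_hom :=
    { one_hom := by
        change (ε F ≫ F.map (h.lift _)) ≫ i = _
        rw [Category.assoc, h.map_lift]
        simp
      mul_hom := by
        change (Functor.LaxMonoidal.μ F R R ≫ F.map (h.lift _)) ≫ i = _
        rw [Category.assoc, h.map_lift, Functor.Monoidal.μ_δ_assoc]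
        rfl }

/-- After `F.map` and `i`, both conditions become the two assumptions on `f`, which say that `f` is
a homomorphism from the image algebra `F(A)`. -/
lemma isMonHom_lift {W : Mon E} {i : F.obj R ⟶ W.X} (h : IsCoreflection F i) {A : Mon D}
    (f : F.obj A.X ⟶ W.X) (one_hom : ε F ≫ F.map η[A.X] ≫ f = η[W.X])
    (mul_hom : Functor.LaxMonoidal.μ F A.X A.X ≫ F.map μ[A.X] ≫ f = (f ⊗ₘ f) ≫ μ[W.X]) :
    @IsMonHom D _ _ A.X R _ h.monObj (h.lift f) := by
  let := h.monObj
  refine ⟨h.hom_ext ?_, h.hom_ext ?_⟩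
  · change _ = F.map (h.lift _) ≫ i
    rw [Functor.map_comp, Category.assoc, h.map_lift, h.map_lift, ← one_hom]
    simp
  · change _ = F.map (_ ≫ h.lift _) ≫ i
    rw [Functor.map_comp, Category.assoc, h.map_lift, Functor.map_comp, Category.assoc,
      h.map_lift, ← δ_natural_assoc, tensorHom_comp_tensorHom_assoc, h.map_lift, ← mul_hom]
    simp

/-- The factorization of a homomorphism of algebras through the coreflection. -/
noncomputable def monLift {W : Mon E} {i : F.obj R ⟶ W.X} (h : IsCoreflection F i) {A : Mon D}
    (f : F.mapMon.obj A ⟶ W) : A ⟶ h.mon where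
  hom := h.lift f.hom
  isMonHom_hom := h.isMonHom_lift f.hom
    ((Category.assoc _ _ _).symm.trans (IsMonHom.one_hom f.hom))
    ((Category.assoc _ _ _).symm.trans (IsMonHom.mul_hom f.hom))

lemma map_monLift {W : Mon E} {i : F.obj R ⟶ W.X} (h : IsCoreflection F i) {A : Mon D}
    (f : F.mapMon.obj A ⟶ W) : F.map (h.monLift f).hom ≫ i = f.hom :=
  h.map_lift f.hom

end IsCoreflection

end Coreflection

/-! ### Uniqueness of intersections -/

section Intersection

variable {E : Type u} [Category.{v} E] [MonoidalCategory E]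

/-- Intersections with a full subcategory are unique up to isomorphism of algebras. -/
lemma IsIntersection.nonempty_iso {P : ObjectProperty E} {I I' Z : Mon E} {j : I ⟶ Z} {j' : I' ⟶ Z}
    (h : IsIntersection P j) (h' : IsIntersection P j') : Nonempty (I ≅ I') := by
  have := h.mono
  have := h'.mono
  obtain ⟨g, hg⟩ := h'.largest I.X j.hom h.mono h.mem
  obtain ⟨g', hg'⟩ := h.largest I'.X j'.hom h'.mono h'.mem
  -- Both conditions may be checked after the monomorphism `j'.hom`, where `g` becomes the
  -- homomorphism `j`.
  have : IsMonHom g :=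
    { one_hom := by
        rw [← cancel_mono j'.hom, Category.assoc, hg, IsMonHom.one_hom, IsMonHom.one_hom]
      mul_hom := by
        rw [← cancel_mono j'.hom, Category.assoc, hg, Category.assoc, IsMonHom.mul_hom,
          IsMonHom.mul_hom, tensorHom_comp_tensorHom_assoc, hg] }
  have : IsIso g := ⟨g', by rw [← cancel_mono j.hom, Category.assoc, hg', hg, Category.id_comp],
    by rw [← cancel_mono j'.hom, Category.assoc, hg, hg', Category.id_comp]⟩
  exact ⟨Mon.mkIso' (asIso g)⟩

end Intersection

/-! ### Actions through a braided functor and actions of its image -/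

section UnitalAction

variable {M : Type u} [Category.{v} M] [MonoidalCategory M]
  {D : Type u₁} [Category.{v₁} D] [MonoidalCategory D] [BraidedCategory D]

/-- The transported structure is composed with the identity structure maps of `𝟭 E`, so the equality
is not definitional. It is the one correction needed to compare actions through `F` with actions
through `𝟭`. -/
lemma id_monObjObj {E : Type u} [Category.{v} E] [MonoidalCategory E] (X : E) [m : MonObj X] :
    (𝟭 E).monObjObj X = m := by
  apply MonObj.ext
  exact Category.id_comp _

/-- The algebra homomorphism `A ⊙ N ⟶ N` underlying an action through `F`, as an action of the
image of `A` in the Drinfeld center, and conversely. -/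
lemma isMonHom_actAlg_id_iff (F : D ⥤ Center M) [F.Braided] (A : Mon D) (N : Mon M)
    (f : actObj F A.X N.X ⟶ N.X) :
    @IsMonHom M _ _ (actAlg (𝟭 (Center M)) (F.mapMon.obj A) N).X N.X
        (actAlg (𝟭 (Center M)) (F.mapMon.obj A) N).mon _ f ↔
      @IsMonHom M _ _ (actAlg F A N).X N.X (actAlg F A N).mon _ f := by
  have e := id_monObjObj (F.mapMon.obj A).X
  change @IsMonHom M _ _ (actObj F A.X N.X) N.X (@centerTensorMonObj M _ _ (F.obj A.X)
    ((𝟭 (Center M)).monObjObj (F.mapMon.obj A).X) N.X _) _ f ↔ _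
  rw [e]
  rfl

/-- The morphism `ε F` belongs to the unit of the image algebra on the left and to the isomorphism
`N ≅ 𝟙 ⊙ N` on the right; only the bracketing differs. -/
lemma actUnit_id_mapMon (F : D ⥤ Center M) [F.Braided] (A : Mon D) (N : M) :
    (actUnitIso (𝟭 (Center M)) N).hom ≫ actMap (𝟭 (Center M)) η[(F.mapMon.obj A).X] N =
      (actUnitIso F N).hom ≫ actMap F η[A.X] N := by
  have e : ∀ {X Y : M} (a : 𝟙_ M ⟶ X) (b : X ⟶ Y),
      (𝟙 (𝟙_ M) ≫ 𝟙 (𝟙_ M)) ▷ N ≫ (a ≫ b) ▷ N = (𝟙 (𝟙_ M) ≫ a) ▷ N ≫ b ▷ N := by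
    simp
  exact (Category.assoc _ _ _).trans ((congrArg ((λ_ N).inv ≫ ·)
    (e (Functor.LaxMonoidal.ε F).f (F.map η[A.X]).f)).trans (Category.assoc _ _ _).symm)

/-- An action through `F`, as an action of the image of the algebra in the Drinfeld center. -/
def UnitalAction.toCenter {F : D ⥤ Center M} [F.Braided] {A : Mon D} {N : Mon M}
    (t : UnitalAction F A N) : UnitalAction (𝟭 (Center M)) (F.mapMon.obj A) N where
  act :=
    { hom := t.act.hom
      isMonHom_hom := (isMonHom_actAlg_id_iff F A N t.act.hom).2 t.act.isMonHom_hom }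
  unital := (Category.assoc _ _ _).symm.trans (((actUnit_id_mapMon F A N.X) =≫ t.act.hom).trans
    ((Category.assoc _ _ _).trans t.unital))

/-- An action of the image of an algebra in the Drinfeld center, as an action through `F`. -/
def UnitalAction.ofCenter {F : D ⥤ Center M} [F.Braided] {A : Mon D} {N : Mon M}
    (t : UnitalAction (𝟭 (Center M)) (F.mapMon.obj A) N) : UnitalAction F A N where
  act :=
    { hom := t.act.hom
      isMonHom_hom := (isMonHom_actAlg_id_iff F A N t.act.hom).1 t.act.isMonHom_hom }
  unital := (Category.assoc _ _ _).symm.trans (((actUnit_id_mapMon F A N.X).symm =≫ t.act.hom).trans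
    ((Category.assoc _ _ _).trans t.unital))

end UnitalAction

/-! ### The largest subobject whose half-braiding is the braiding -/

section Transparent

variable {C : Type u} [Category.{v} C] [Abelian C] [MonoidalCategory C]

/-- The duality bijection is natural in `Y` and preserves zero. A condition on `f ▷ U` thus becomes
one on `f`, which a kernel can solve. -/
lemma whiskerRight_comp_eq_zero_iff [MonoidalPreadditive C] [RigidCategory C] {W Y U V : C}
    (f : Y ⟶ W) (d : W ⊗ U ⟶ V) :
    f ▷ U ≫ d = 0 ↔ f ≫ tensorRightHomEquiv W U (Uᘁ) V d = 0 := by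
  have hz : (tensorRightHomEquiv Y U (Uᘁ) V).symm 0 = 0 := by simp [tensorRightHomEquiv]
  have h := tensorRightHomEquiv_symm_naturality (Y := U) f (tensorRightHomEquiv W U (Uᘁ) V d)
  rw [Equiv.symm_apply_apply] at h
  rw [← h, ← hz, Equiv.apply_eq_iff_eq]

variable [BraidedCategory C]

/-- The difference between the half-braiding of an object of the Drinfeld center and the braiding. -/
noncomputable def braidingDefect (Z : Center C) (U : C) : Z.1 ⊗ U ⟶ U ⊗ Z.1 :=
  (Z.2.β U).hom - (β_ Z.1 U).hom

lemma braidingDefect_naturality (Z : Center C) {U V : C} (f : U ⟶ V) :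
    Z.1 ◁ f ≫ braidingDefect Z V = braidingDefect Z U ≫ f ▷ Z.1 := by
  simp [braidingDefect, Preadditive.comp_sub, Preadditive.sub_comp]

/-- The left-hand side is the condition at `U` for `f` to be a morphism from `(Y, β)` to `Z` in the
center; naturality of the braiding in `f` makes it linear. -/
lemma comm_iff_braidingDefect (Z : Center C) {Y : C} (f : Y ⟶ Z.1) (U : C) :
    f ▷ U ≫ (Z.2.β U).hom = (β_ Y U).hom ≫ U ◁ f ↔ f ▷ U ≫ braidingDefect Z U = 0 := by
  rw [braidingDefect, Preadditive.comp_sub, sub_eq_zero, BraidedCategory.braiding_naturality_left]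

variable [MonoidalPreadditive C]

/-- If the braiding defect vanishes on a generating family, it vanishes on biproducts. -/
lemma whiskerRight_braidingDefect_eq_zero (Z : Center C) {Y : C} (f : Y ⟶ Z.1) {n m : ℕ}
    (S : Fin n → C) (h : ∀ k, f ▷ S k ≫ braidingDefect Z (S k) = 0) {U : C} (T : Fin m → C)
    (hT : ∀ k, ∃ l, Nonempty (T k ≅ S l)) (e : U ≅ ⨁ T) : f ▷ U ≫ braidingDefect Z U = 0 := by
  -- By naturality of the defect, vanishing at `V'` passes to `V` after precomposition with `Y ◁ g`.
  -- This is used for `e.inv`, the inclusions of the summands and `a.inv`.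
  have key : ∀ {V V' : C} (g : V' ⟶ V), f ▷ V' ≫ braidingDefect Z V' = 0 →
      Y ◁ g ≫ f ▷ V ≫ braidingDefect Z V = 0 := by
    intro V V' g hg
    rw [whisker_exchange_assoc, braidingDefect_naturality, reassoc_of% hg, zero_comp]
  rw [← cancel_epi (Y ◁ e.inv), comp_zero]
  refine key _ (leftDistributor_ext_left fun k => ?_)
  obtain ⟨l, ⟨a⟩⟩ := hT k
  rw [comp_zero]
  refine key _ ?_
  rw [← cancel_epi (Y ◁ a.inv), comp_zero]
  exact key _ (h l)

/-- Every object of the Drinfeld center has a largest subobject on which the half-braiding is the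
braiding. -/
lemma exists_leftEmbedding_mono [RigidCategory C] {n : ℕ} (S : Fin n → C)
    (hS : ∀ X : C, ∃ (m : ℕ) (T : Fin m → C), (∀ k, ∃ l, Nonempty (T k ≅ S l)) ∧
      Nonempty (X ≅ ⨁ T)) (Z : Center C) :
    ∃ (R : C) (i : (leftEmbedding C).obj R ⟶ Z), Mono i.f ∧
      ∀ (Y : C) (f : (leftEmbedding C).obj Y ⟶ Z), ∃ g : Y ⟶ R, g ≫ i.f = f.f := by
  -- The components of `d` are the duality mates of the defects at the `S k`, so the kernel of `d`
  -- is the largest subobject on which all of these vanish.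
  let d : Z.1 ⟶ ⨁ fun k => (S k ⊗ Z.1) ⊗ (S k)ᘁ :=
    biproduct.lift fun k => tensorRightHomEquiv Z.1 (S k) (S k)ᘁ _ (braidingDefect Z (S k))
  have hd : ∀ {Y : C} (f : Y ⟶ Z.1), f ≫ d = 0 ↔
      ∀ k, f ▷ S k ≫ braidingDefect Z (S k) = 0 := by
    intro Y f
    simp only [whiskerRight_comp_eq_zero_iff]
    constructor
    · intro h k
      have := h =≫ biproduct.π _ k
      simpa [d] using this
    · intro h
      ext k
      simpa [d] using h k
  refine ⟨kernel d, ⟨kernel.ι d, fun U => ?_⟩, ?_, ?_⟩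
  · obtain ⟨m, T, hT, ⟨e⟩⟩ := hS U
    exact (comm_iff_braidingDefect Z _ U).2
      (whiskerRight_braidingDefect_eq_zero Z _ S ((hd _).1 (kernel.condition d)) T hT e)
  · change Mono (kernel.ι d)
    infer_instance
  · intro Y f
    have h0 : f.f ≫ d = 0 := (hd f.f).2 fun k => (comm_iff_braidingDefect Z f.f _).1 (f.comm _)
    exact ⟨kernel.lift d f.f h0, kernel.lift_ι d f.f h0⟩

end Transparent

/-! ### Left centers and intersections -/

section LeftCenter

variable {M : Type u} [Category.{v} M] [MonoidalCategory M]
  {D : Type u₁} [Category.{v₁} D]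

lemma actMap_comp (F : D ⥤ Center M) {A A' A'' : D} (f : A ⟶ A') (g : A' ⟶ A'') (N : M) :
    actMap F (f ≫ g) N = actMap F f N ≫ actMap F g N := by
  rw [actMap, Functor.map_comp, Functor.map_comp, comp_whiskerRight]

lemma actMap_id (F : D ⥤ Center M) (A : D) (N : M) : actMap F (𝟙 A) N = 𝟙 _ := by
  rw [actMap, CategoryTheory.Functor.map_id, CategoryTheory.Functor.map_id, id_whiskerRight]

variable [MonoidalCategory D] [BraidedCategory D]

/-- Left centers are unique up to isomorphism of algebras. -/
lemma IsLeftCenter.nonempty_iso {F : D ⥤ Center M} [F.Braided] {N : Mon M} {Z Z' : Mon D}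
    {u : UnitalAction F Z N} {u' : UnitalAction F Z' N} (h : IsLeftCenter F N Z u)
    (h' : IsLeftCenter F N Z' u') : Nonempty (Z ≅ Z') := by
  obtain ⟨f, hf, -⟩ := h' Z u
  obtain ⟨g, hg, -⟩ := h Z' u'
  have id : ∀ {X : Mon D} (t : actObj F X.X N.X ⟶ N.X),
      actMap F (Mon.Hom.hom (𝟙 X)) N.X ≫ t = t := by
    intro X t
    rw [Mon.id_hom', actMap_id, Category.id_comp]
  have comp : ∀ {X Y W : Mon D} (a : X ⟶ Y) (b : Y ⟶ W) {r s t}, actMap F a.hom N.X ≫ s = r →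
      actMap F b.hom N.X ≫ t = s → actMap F (a ≫ b).hom N.X ≫ t = (r : _ ⟶ N.X) := by
    intro X Y W a b r s t hr hs
    rw [Mon.comp_hom', actMap_comp, Category.assoc, hs, hr]
  exact ⟨⟨f, g, (h Z u).unique (comp f g hf hg) (id _), (h' Z' u').unique (comp g f hg hf) (id _)⟩⟩

/-- A homomorphism `z ⟶ z'` compatible with the ways to move `n` past `z` and `z'` induces a
homomorphism of the algebra structures on `z ⊗ n` and `z' ⊗ n`. -/
lemma isMonHom_twisted_whiskerRight {z z' n : M} [MonObj z] [MonObj z'] [MonObj n]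
    {s : n ⊗ z ⟶ z ⊗ n} {s' : n ⊗ z' ⟶ z' ⊗ n} (f : z ⟶ z') [IsMonHom f]
    (w : n ◁ f ≫ s' = s ≫ f ▷ n) (m : MonObj (z ⊗ n)) (m' : MonObj (z' ⊗ n))
    (hone : m.one = (λ_ (𝟙_ M)).inv ≫ (η[z] ⊗ₘ η[n]))
    (hmul : m.mul = (α_ z n (z ⊗ n)).hom ≫ z ◁ ((α_ n z n).inv ≫ s ▷ n ≫ (α_ z n n).hom) ≫
      (α_ z z (n ⊗ n)).inv ≫ (μ[z] ⊗ₘ μ[n]))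
    (hone' : m'.one = (λ_ (𝟙_ M)).inv ≫ (η[z'] ⊗ₘ η[n]))
    (hmul' : m'.mul = (α_ z' n (z' ⊗ n)).hom ≫
      z' ◁ ((α_ n z' n).inv ≫ s' ▷ n ≫ (α_ z' n n).hom) ≫
      (α_ z' z' (n ⊗ n)).inv ≫ (μ[z'] ⊗ₘ μ[n])) :
    IsMonHom (f ▷ n) := by
  refine ⟨?_, ?_⟩
  · rw [hone, hone', Category.assoc, ← tensorHom_id, tensorHom_comp_tensorHom, IsMonHom.one_hom,
      Category.comp_id]
  · rw [hmul, hmul']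
    symm
    -- The second copy of `f` moves past `n` by `w` and meets the first; multiplicativity of `f`
    -- then applies.
    calc
      _ = 𝟙 _ ⊗≫ f ▷ (n ⊗ z ⊗ n) ⊗≫ z' ◁ (n ◁ f ≫ s') ▷ n ⊗≫ μ[z'] ▷ (n ⊗ n) ⊗≫ z' ◁ μ[n] := by
        simp only [MonoidalCategory.tensorHom_def]
        monoidal
      _ = 𝟙 _ ⊗≫ (f ▷ (n ⊗ z) ≫ z' ◁ s) ▷ n ⊗≫ z' ◁ f ▷ (n ⊗ n) ⊗≫ μ[z'] ▷ (n ⊗ n) ⊗≫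
          z' ◁ μ[n] := by
        rw [w]
        monoidal
      _ = 𝟙 _ ⊗≫ z ◁ s ▷ n ⊗≫ ((f ▷ z ≫ z' ◁ f) ≫ μ[z']) ▷ (n ⊗ n) ⊗≫ z' ◁ μ[n] := by
        rw [← whisker_exchange]
        monoidal
      _ = 𝟙 _ ⊗≫ z ◁ s ▷ n ⊗≫ μ[z] ▷ (n ⊗ n) ⊗≫ (f ▷ (n ⊗ n) ≫ z' ◁ μ[n]) := by
        rw [← MonoidalCategory.tensorHom_def, ← IsMonHom.mul_hom]
        monoidal
      _ = _ := by
        rw [← whisker_exchange]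
        simp only [MonoidalCategory.tensorHom_def]
        monoidal

/-- The homomorphism `f ⊙ N` of algebras in `M`. -/
noncomputable def actAlgMap (F : D ⥤ Center M) [F.Braided] {A A' : Mon D} (f : A ⟶ A')
    (N : Mon M) : actAlg F A N ⟶ actAlg F A' N where
  hom := actMap F f.hom N.X
  isMonHom_hom := by
    let := F.monObjObj A.X
    let := F.monObjObj A'.X
    let := (Center.forget M).monObjObj (F.obj A.X)
    let := (Center.forget M).monObjObj (F.obj A'.X)
    -- Morphisms of the center commute with the inverse half-braidings, which is the compatibility
    -- required here.
    exact isMonHom_twisted_whiskerRight _ (centerPass_hom (F.map f.hom) N.X) _ _ rfl rfl rfl rfl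

/-- Restriction of an action along a homomorphism of algebras. -/
noncomputable def UnitalAction.restrict {F : D ⥤ Center M} [F.Braided] {N : Mon M} {Z : Mon D}
    (u : UnitalAction F Z N) {A : Mon D} (f : A ⟶ Z) : UnitalAction F A N where
  act := actAlgMap F f N ≫ u.act
  unital := by
    refine Eq.trans (congrArg _ ?_) u.unital
    refine (Category.assoc _ _ _).symm.trans (congrArg (· ≫ u.act.hom) ?_)
    exact (actMap_comp F _ _ _).symm.trans
      (congrArg (actMap F · N.X) (IsMonHom.one_hom f.hom))

variable {F : D ⥤ Center M} [F.Braided] {N : Mon M} {Z : Mon (Center M)}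
  {u : UnitalAction (𝟭 (Center M)) Z N} {R : D} {i : F.obj R ⟶ Z.X}

/-- The coreflection of the full center is a left center. -/
lemma IsFullCenter.isLeftCenter (hZ : IsFullCenter N Z u) (h : IsCoreflection F i) :
    IsLeftCenter F N h.mon (u.restrict h.counit).ofCenter := by
  intro A t
  obtain ⟨f, hf, hf'⟩ := hZ (F.mapMon.obj A) t.toCenter
  -- Acting through `g` on the coreflection is acting through its adjunct `F(A) ⟶ Z`, so existence
  -- and uniqueness both transfer from `Z`.
  have key : ∀ g : A ⟶ h.mon, actMap F g.hom N.X ≫ (u.restrict h.counit).ofCenter.act.hom =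
      actMap (𝟭 (Center M)) (F.mapMon.map g ≫ h.counit).hom N.X ≫ u.act.hom := by
    intro g
    refine (Category.assoc _ _ _).symm.trans (congrArg (· ≫ u.act.hom) ?_)
    exact (comp_whiskerRight _ _ _).symm
  refine ⟨h.monLift f, ?_, fun g hg => ?_⟩
  · refine (key _).trans (Eq.trans ?_ hf)
    congr 2
    exact h.map_monLift f
  · apply Mon.Hom.ext
    refine h.hom_ext (Eq.trans ?_ (h.map_monLift f).symm)
    exact congrArg Mon.Hom.hom (hf' (F.mapMon.map g ≫ h.counit) ((key g).symm.trans hg))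

/-- A coreflection factors every morphism from an object of the essential image, in particular every
subobject inclusion. -/
lemma IsCoreflection.isIntersection {Z : Mon (Center M)} {i : F.obj R ⟶ Z.X} [Mono i]
    (h : IsCoreflection F i) {P : ObjectProperty (Center M)}
    (hP : ∀ W, P W ↔ ∃ X, Nonempty (W ≅ F.obj X)) : IsIntersection P h.counit where
  mono := by assumption
  mem := (hP _).2 ⟨R, ⟨Iso.refl _⟩⟩
  largest S s _ hS := by
    obtain ⟨X, ⟨e⟩⟩ := (hP S).1 hS
    refine ⟨e.hom ≫ F.map (h.lift (e.inv ≫ s)), ?_⟩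
    change (e.hom ≫ F.map (h.lift (e.inv ≫ s))) ≫ i = s
    rw [Category.assoc, h.map_lift, Iso.hom_inv_id_assoc]

/-- The left center of `N` in `D` exists, and is the intersection of the full center with the
essential image of `D`, if the full center has a coreflection that is a subobject. -/
theorem IsFullCenter.leftCenter_intersection (hZ : IsFullCenter N Z u) [Mono i]
    (h : IsCoreflection F i) {P : ObjectProperty (Center M)}
    (hP : ∀ W, P W ↔ ∃ X, Nonempty (W ≅ F.obj X)) :
    (∃ (I : Mon (Center M)) (j : I ⟶ Z), IsIntersection P j) ∧
      (∃ (Zl : Mon D) (ul : UnitalAction F Zl N), IsLeftCenter F N Zl ul) ∧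
      ∀ (I : Mon (Center M)) (j : I ⟶ Z), IsIntersection P j →
        ∀ (Zl : Mon D) (ul : UnitalAction F Zl N), IsLeftCenter F N Zl ul →
          Nonempty (F.mapMon.obj Zl ≅ I) := by
  refine ⟨⟨_, _, h.isIntersection hP⟩, ⟨_, _, hZ.isLeftCenter h⟩, fun I j hj Zl ul hl => ?_⟩
  obtain ⟨e⟩ := hl.nonempty_iso (hZ.isLeftCenter h)
  obtain ⟨e'⟩ := (h.isIntersection hP).nonempty_iso hj
  exact ⟨F.mapMon.mapIso e ≪≫ e'⟩

end LeftCenter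

/-! ### Coreflections along the two embeddings -/

section Embedding

/-- Every object of the Drinfeld center has a coreflection along the left embedding, which is a
subobject. -/
lemma exists_leftEmbedding_coreflection {C : Type u} [Category.{v} C] [Abelian C]
    [MonoidalCategory C] [MonoidalPreadditive C] [RigidCategory C] [BraidedCategory C]
    {n : ℕ} (S : Fin n → C)
    (hS : ∀ X : C, ∃ (m : ℕ) (T : Fin m → C), (∀ k, ∃ l, Nonempty (T k ≅ S l)) ∧
      Nonempty (X ≅ ⨁ T)) (Z : Center C) :
    ∃ (R : C) (i : (leftEmbedding C).obj R ⟶ Z), Mono i ∧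
      IsCoreflection (leftEmbedding C) i := by
  obtain ⟨R, i, hi, h⟩ := exists_leftEmbedding_mono S hS Z
  -- The forgetful functor is faithful, so `i` is mono because `i.f` is.
  refine ⟨R, i, ⟨fun a b w => Center.ext _ _ ((cancel_mono i.f).1 (congrArg Center.Hom.f w))⟩,
    fun Y f => ?_⟩
  obtain ⟨g, hg⟩ := h Y f
  exact ⟨g, Center.ext _ _ hg,
    fun g' hg' => (cancel_mono i.f).1 ((congrArg Center.Hom.f hg').trans hg.symm)⟩

/-- By definition `rightEmbedding C` is the left embedding for the reversed braiding. -/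
lemma exists_rightEmbedding_coreflection {C : Type u} [Category.{v} C] [Abelian C]
    [MonoidalCategory C] [MonoidalPreadditive C] [RigidCategory C] [BraidedCategory C]
    {n : ℕ} (S : Fin n → C)
    (hS : ∀ X : C, ∃ (m : ℕ) (T : Fin m → C), (∀ k, ∃ l, Nonempty (T k ≅ S l)) ∧
      Nonempty (X ≅ ⨁ T)) (Z : Center C) :
    ∃ (R : RevBraided C) (i : (rightEmbedding C).obj R ⟶ Z), Mono i ∧
      IsCoreflection (rightEmbedding C) i :=
  @exists_leftEmbedding_coreflection C _ _ _ _ _ (reverseBraiding C) n S hS Z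

variable {C : Type u} [Category.{v} C] [MonoidalCategory C] [BraidedCategory C]

/-- The other embedding preserves the unit, so the factor `𝟙` can be dropped. -/
lemma leftFactor_iff (W : Center C) :
    leftFactor C W ↔ ∃ X, Nonempty (W ≅ (leftEmbedding C).obj X) := by
  have e : ∀ X : C, boxProd X (𝟙_ (RevBraided C)) ≅ (leftEmbedding C).obj X := fun X =>
    whiskerLeftIso _ (Functor.Monoidal.εIso (rightEmbedding C)).symm ≪≫ ρ_ _
  exact exists_congr fun X => ⟨fun ⟨a⟩ => ⟨a ≪≫ e X⟩, fun ⟨a⟩ => ⟨a ≪≫ (e X).symm⟩⟩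

lemma rightFactor_iff (W : Center C) :
    rightFactor C W ↔ ∃ Y, Nonempty (W ≅ (rightEmbedding C).obj Y) := by
  have e : ∀ Y : RevBraided C, boxProd (𝟙_ C) Y ≅ (rightEmbedding C).obj Y := fun Y =>
    whiskerRightIso (Functor.Monoidal.εIso (leftEmbedding C)).symm _ ≪≫ λ_ _
  exact exists_congr fun X => ⟨fun ⟨a⟩ => ⟨a ≪≫ e X⟩, fun ⟨a⟩ => ⟨a ≪≫ (e X).symm⟩⟩

end Embedding

theorem mainTheorem6 {C : Type u} [Category.{v} C] [Abelian C] [Linear ℂ C]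
    [MonoidalCategory C] [MonoidalPreadditive C] [MonoidalLinear ℂ C] [RigidCategory C]
    [BraidedCategory C] [ModularTensorCategory C]
    (B : Mon C) (hB : IsCondensableAlg B)
    (Z : Mon (Center C)) (u : UnitalAction (𝟭 (Center C)) Z B) (hZ : IsFullCenter B Z u) :
    ((∃ (I : Mon (Center C)) (j : I ⟶ Z), IsIntersection (leftFactor C) j) ∧
      (∃ (Zl : Mon C) (ul : UnitalAction (leftEmbedding C) Zl B),
        IsLeftCenter (leftEmbedding C) B Zl ul) ∧
      ∀ (I : Mon (Center C)) (j : I ⟶ Z), IsIntersection (leftFactor C) j →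
        ∀ (Zl : Mon C) (ul : UnitalAction (leftEmbedding C) Zl B),
          IsLeftCenter (leftEmbedding C) B Zl ul →
            Nonempty ((leftEmbedding C).mapMon.obj Zl ≅ I)) ∧
    ((∃ (I : Mon (Center C)) (j : I ⟶ Z), IsIntersection (rightFactor C) j) ∧
      (∃ (Zr : Mon (RevBraided C)) (ur : UnitalAction (rightEmbedding C) Zr B),
        IsLeftCenter (rightEmbedding C) B Zr ur) ∧
      ∀ (I : Mon (Center C)) (j : I ⟶ Z), IsIntersection (rightFactor C) j →
        ∀ (Zr : Mon (RevBraided C)) (ur : UnitalAction (rightEmbedding C) Zr B),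
          IsLeftCenter (rightEmbedding C) B Zr ur →
            Nonempty ((rightEmbedding C).mapMon.obj Zr ≅ I)) := by
  obtain ⟨n, S, hS⟩ := ModularTensorCategory.finite_simples (C := C)
  -- Finite semisimplicity: the finite list `S` generates `C` under biproducts.
  have hS' : ∀ X : C, ∃ (m : ℕ) (T : Fin m → C), (∀ k, ∃ l, Nonempty (T k ≅ S l)) ∧
      Nonempty (X ≅ ⨁ T) := fun X => by
    obtain ⟨m, T, hT, e⟩ := ModularTensorCategory.semisimple X
    exact ⟨m, T, fun k => hS _ (hT k), e⟩
  obtain ⟨_, i, _, hi⟩ := exists_leftEmbedding_coreflection S hS' Z.X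
  obtain ⟨_, i', _, hi'⟩ := exists_rightEmbedding_coreflection S hS' Z.X
  exact ⟨hZ.leftCenter_intersection hi leftFactor_iff,
    hZ.leftCenter_intersection hi' rightFactor_iff⟩
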